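/- Let $G$ be a compact Lie group, let $U$ and $V$ be strongly continuous unitary representations of $G$ on complex Hilbert spaces $\mathcal H$ and $\mathcal K$ (of arbitrary dimension, possibly equal), and let $\psi\in\mathcal H$ and $\phi\in\mathcal K$ be unit vectors. A quantum channel from $\mathcal H$ to $\mathcal K$ is a linear, completely positive, trace-preserving map $\mathcal E$ from the trace class operators on $\mathcal H$ to those on $\mathcal K$; it is $G$-covariant if $\mathcal E(U(g)AU(g)^\dagger)=V(g)\mathcal E(A)V(g)^\dagger$ for all $g\in G$ and all trace class $A$, and similarly with the roles of $(\mathcal H,U)$ and $(\mathcal K,V)$ exchanged. The pure states $\psi$ and $\phi$ are called $G$-equivalent if some $G$-covariant channel from $\mathcal H$ to $\mathcal K$ maps $|\psi\rangle\langle\psi|$ to $|\phi\rangle\langle\phi|$ and some $G$-covariant channel from $\mathcal K$ to $\mathcal H$ maps $|\phi\rangle\langle\phi|$ to $|\psi\rangle\langle\psi|$. Put $\chi_\psi(g)=\langle\psi|U(g)|\psi\rangle$ and $\chi_\phi(g)=\langle\phi|V(g)|\phi\rangle$. Consider the condition $(\ast)$ there is a 1-dimensional unitary representation of $G$, that is,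 a continuous homomorphism $g\mapsto e^{i\Theta(g)}$ from $G$ to the unit circle, such that $\chi_\psi(g)=\chi_\phi(g)\,e^{i\Theta(g)}$ for all $g\in G$. Then $(\ast)$ implies that $\psi$ and $\phi$ are $G$-equivalent. If moreover $G$ is connected, or $\chi_\psi$ and $\chi_\phi$ vanish nowhere on $G$, then $\psi$ and $\phi$ are $G$-equivalent if and only if $(\ast)$ holds. -/

import Mathlib

open scoped InnerProductSpace ComplexOrder ContDiff Manifold

noncomputable section

namespace Asymmetry

section TraceClass

variable {H : Type*} [NormedAddCommGroup H] [InnerProductSpace ℂ H]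

/-- `A = ∑ₙ |xₙ⟩⟨yₙ|` with `∑ₙ ‖xₙ‖ ‖yₙ‖ < ∞`. -/
structure IsNuclearExpansion (A : H →L[ℂ] H) (x y : ℕ → H) : Prop where
  summable : Summable fun n => ‖x n‖ * ‖y n‖
  hasSum : ∀ v, HasSum (fun n => ⟪y n, v⟫_ℂ • x n) (A v)

/-- An operator on a Hilbert space is trace class iff it is nuclear, that is, an absolutely
convergent sum of operators of rank at most one. On a finite-dimensional space every operator is
trace class. -/
def IsTraceClass (A : H →L[ℂ] H) : Prop :=
  ∃ x y : ℕ → H, IsNuclearExpansion A x y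

theorem IsTraceClass.rankOne (x y : H) : IsTraceClass (InnerProductSpace.rankOne ℂ x y) := by
  refine ⟨Pi.single 0 x, Pi.single 0 y, ?_, fun v => ?_⟩
  · refine summable_of_ne_finset_zero (s := {0}) fun n hn => ?_
    have hn : n ≠ 0 := by simpa using hn
    simp [hn]
  · have h := hasSum_single (f := fun n => ⟪(Pi.single 0 y : ℕ → H) n, v⟫_ℂ •
        (Pi.single 0 x : ℕ → H) n) 0 fun n hn => by simp [hn]
    simpa using h

theorem IsTraceClass.add {A B : H →L[ℂ] H} (hA : IsTraceClass A) (hB : IsTraceClass B) :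
    IsTraceClass (A + B) := by
  obtain ⟨x, y, hxy⟩ := hA
  obtain ⟨x', y', hxy'⟩ := hB
  have e0 : ∀ k : ℕ, Even (2 * k) := fun k => even_two_mul k
  have e1 : ∀ k : ℕ, ¬ Even (2 * k + 1) := fun k => by simp
  have d0 : ∀ k : ℕ, 2 * k / 2 = k := fun k => by omega
  have d1 : ∀ k : ℕ, (2 * k + 1) / 2 = k := fun k => by omega
  refine ⟨fun n => if Even n then x (n / 2) else x' (n / 2),
    fun n => if Even n then y (n / 2) else y' (n / 2), ?_, fun v => ?_⟩
  · refine Summable.even_add_odd ?_ ?_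
    · simpa only [e0, d0, if_true] using hxy.summable
    · simpa only [e1, d1, if_false] using hxy'.summable
  · refine HasSum.even_add_odd ?_ ?_
    · simpa [e0, d0] using hxy.hasSum v
    · simpa [e1, d1] using hxy'.hasSum v

theorem IsTraceClass.smul {A : H →L[ℂ] H} (c : ℂ) (hA : IsTraceClass A) :
    IsTraceClass (c • A) := by
  obtain ⟨x, y, hxy⟩ := hA
  refine ⟨fun n => c • x n, y, ?_, fun v => ?_⟩
  · simpa only [norm_smul, mul_assoc] using hxy.summable.mul_left ‖c‖
  · simpa [smul_comm c] using (hxy.hasSum v).const_smul c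

theorem IsTraceClass.conj [CompleteSpace H] {K : Type*} [NormedAddCommGroup K]
    [InnerProductSpace ℂ K] [CompleteSpace K] {A : H →L[ℂ] H} (T : H →L[ℂ] K)
    (hA : IsTraceClass A) : IsTraceClass (T ∘L A ∘L ContinuousLinearMap.adjoint T) := by
  obtain ⟨x, y, hxy⟩ := hA
  refine ⟨fun n => T (x n), fun n => T (y n), ?_, fun v => ?_⟩
  · refine Summable.of_nonneg_of_le (fun n => by positivity) (fun n => ?_)
      (hxy.summable.mul_left (‖T‖ * ‖T‖))
    calc ‖T (x n)‖ * ‖T (y n)‖ ≤ (‖T‖ * ‖x n‖) * (‖T‖ * ‖y n‖) := by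
          gcongr <;> exact T.le_opNorm _
      _ = ‖T‖ * ‖T‖ * (‖x n‖ * ‖y n‖) := by ring
  · have h := (hxy.hasSum (ContinuousLinearMap.adjoint T v)).mapL T
    simpa [ContinuousLinearMap.adjoint_inner_right] using h

variable (H) in
/-- The complex vector space of trace class operators on `H`. -/
def traceClass : Submodule ℂ (H →L[ℂ] H) where
  carrier := {A | IsTraceClass A}
  add_mem' := IsTraceClass.add
  zero_mem' := by simpa using IsTraceClass.rankOne (0 : H) 0
  smul_mem' c _ h := IsTraceClass.smul c h

/-- The diagonal of a trace class operator in any orthonormal basis is summable, and its sum does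
not depend on the basis. -/
theorem IsNuclearExpansion.hasSum_diagonal {A : H →L[ℂ] H} {x y : ℕ → H}
    (h : IsNuclearExpansion A x y) {ι : Type*} (b : HilbertBasis ι ℂ H) :
    HasSum (fun i => ⟪b i, A (b i)⟫_ℂ) (∑' n, ⟪y n, x n⟫_ℂ) := by
  have hrow : ∀ n, HasSum (fun i => ⟪y n, b i⟫_ℂ * ⟪b i, x n⟫_ℂ) ⟪y n, x n⟫_ℂ := fun n =>
    b.hasSum_inner_mul_inner (y n) (x n)
  have hsq : ∀ v : H, HasSum (fun i => ‖⟪b i, v⟫_ℂ‖ ^ 2) (‖v‖ ^ 2) := fun v => by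
    have h1 := (b.hasSum_inner_mul_inner v v).mapL Complex.reCLM
    have h2 : Complex.reCLM ⟪v, v⟫_ℂ = ‖v‖ ^ 2 := by
      simpa using inner_self_eq_norm_sq (𝕜 := ℂ) v
    rw [h2] at h1
    refine h1.congr_fun fun i => ?_
    rw [← inner_conj_symm v (b i), ← Complex.normSq_eq_conj_mul_self, Complex.reCLM_apply,
      Complex.ofReal_re, Complex.normSq_eq_norm_sq]
  have hsum : Summable fun p : ℕ × ι => ⟪y p.1, b p.2⟫_ℂ * ⟪b p.2, x p.1⟫_ℂ := by
    apply Summable.of_norm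
    have hfin : ∀ (n : ℕ) (s : Finset ι),
        ∑ i ∈ s, ‖⟪y n, b i⟫_ℂ * ⟪b i, x n⟫_ℂ‖ ≤ ‖x n‖ * ‖y n‖ := fun n s => by
      have hle : ∀ v : H, √(∑ i ∈ s, ‖⟪b i, v⟫_ℂ‖ ^ 2) ≤ ‖v‖ := fun v =>
        Real.sqrt_le_iff.2 ⟨norm_nonneg v, sum_le_hasSum s (fun i _ => by positivity) (hsq v)⟩
      calc ∑ i ∈ s, ‖⟪y n, b i⟫_ℂ * ⟪b i, x n⟫_ℂ‖
          = ∑ i ∈ s, ‖⟪b i, x n⟫_ℂ‖ * ‖⟪b i, y n⟫_ℂ‖ := by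
            refine Finset.sum_congr rfl fun i _ => ?_
            rw [norm_mul, norm_inner_symm (y n) (b i), mul_comm]
        _ ≤ √(∑ i ∈ s, ‖⟪b i, x n⟫_ℂ‖ ^ 2) * √(∑ i ∈ s, ‖⟪b i, y n⟫_ℂ‖ ^ 2) :=
            Real.sum_mul_le_sqrt_mul_sqrt s _ _
        _ ≤ ‖x n‖ * ‖y n‖ := by gcongr <;> apply hle
    have hrows : ∀ n, Summable fun i => ‖⟪y n, b i⟫_ℂ * ⟪b i, x n⟫_ℂ‖ := fun n =>
      summable_of_sum_le (fun i => norm_nonneg _) (hfin n)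
    refine (summable_prod_of_nonneg fun p => norm_nonneg _).2 ⟨hrows, ?_⟩
    exact Summable.of_nonneg_of_le (fun n => tsum_nonneg fun i => norm_nonneg _)
      (fun n => (hrows n).tsum_le_of_sum_le (hfin n)) h.summable
  have hcol : ∀ i, HasSum (fun n => ⟪y n, b i⟫_ℂ * ⟪b i, x n⟫_ℂ) ⟪b i, A (b i)⟫_ℂ := fun i => by
    simpa [inner_smul_right] using (h.hasSum (b i)).mapL (innerSL ℂ (b i))
  rw [(hsum.hasSum.prod_fiberwise hrow).tsum_eq]
  exact ((Equiv.prodComm ι ℕ).hasSum_iff.2 hsum.hasSum).prod_fiberwise hcol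

variable [CompleteSpace H]

/-- The trace `tr A = ∑ᵢ ⟨bᵢ|A|bᵢ⟩` over an orthonormal basis of `H`; for trace class `A` the choice
of the basis is immaterial, see `IsNuclearExpansion.hasSum_diagonal`. -/
def trace (A : H →L[ℂ] H) : ℂ :=
  ∑' i, ⟪(exists_hilbertBasis ℂ H).choose_spec.choose i,
    A ((exists_hilbertBasis ℂ H).choose_spec.choose i)⟫_ℂ

/-- `T A T†` as a trace class operator, for bounded `T`. -/
def conjBy (T : H →L[ℂ] H) (A : traceClass H) : traceClass H :=
  ⟨T ∘L (A : H →L[ℂ] H) ∘L ContinuousLinearMap.adjoint T, IsTraceClass.conj T A.2⟩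

/-- The operator `|ψ⟩⟨ψ|`, the density operator of the pure state given by a unit vector `ψ`. -/
def pureState (ψ : H) : traceClass H :=
  ⟨InnerProductSpace.rankOne ℂ ψ ψ, IsTraceClass.rankOne ψ ψ⟩

end TraceClass

section Channels

variable {H K : Type*}
  [NormedAddCommGroup H] [InnerProductSpace ℂ H] [CompleteSpace H]
  [NormedAddCommGroup K] [InnerProductSpace ℂ K] [CompleteSpace K]

/-- The block operator with entries `A i j` is positive on the `n`-fold direct sum of `H`. -/
def IsPositiveBlock {n : ℕ} (A : Fin n → Fin n → traceClass H) : Prop :=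
  ∀ v : Fin n → H, 0 ≤ ∑ i, ∑ j, ⟪v i, (A i j : H →L[ℂ] H) (v j)⟫_ℂ

/-- A quantum channel: a linear, completely positive, trace preserving map from the trace class
operators on `H` to those on `K`. Complete positivity says that for all `n` the map applied entrywise
sends positive `n × n` block operators to positive ones. -/
structure IsQuantumChannel (Φ : traceClass H →ₗ[ℂ] traceClass K) : Prop where
  completelyPositive : ∀ (n : ℕ) (A : Fin n → Fin n → traceClass H),
    IsPositiveBlock A → IsPositiveBlock fun i j => Φ (A i j)
  tracePreserving : ∀ A : traceClass H, trace (Φ A : K →L[ℂ] K) = trace (A : H →L[ℂ] H)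

end Channels

section Symmetry

/-- A (strongly continuous) unitary representation of the topological group `G` on `H`. -/
structure UnitaryRep (G H : Type*) [Group G] [TopologicalSpace G]
    [NormedAddCommGroup H] [InnerProductSpace ℂ H] [CompleteSpace H] where
  toHom : G →* unitary (H →L[ℂ] H)
  continuous_apply : ∀ v : H, Continuous fun g => (toHom g : H →L[ℂ] H) v

variable {G H K : Type*} [Group G] [TopologicalSpace G]
  [NormedAddCommGroup H] [InnerProductSpace ℂ H] [CompleteSpace H]
  [NormedAddCommGroup K] [InnerProductSpace ℂ K] [CompleteSpace K]

/-- The operator `U(g)`. -/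
def UnitaryRep.op (U : UnitaryRep G H) (g : G) : H →L[ℂ] H := U.toHom g

/-- `Φ(U(g) A U(g)†) = V(g) Φ(A) V(g)†` for all `g` and `A`. -/
def IsCovariant (U : UnitaryRep G H) (V : UnitaryRep G K)
    (Φ : traceClass H →ₗ[ℂ] traceClass K) : Prop :=
  ∀ (g : G) (A : traceClass H), Φ (conjBy (U.op g) A) = conjBy (V.op g) (Φ A)

/-- Some `G`-covariant quantum channel takes `ρ` to `σ`. -/
def CovariantlyConvertible (U : UnitaryRep G H) (V : UnitaryRep G K)
    (ρ : traceClass H) (σ : traceClass K) : Prop :=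
  ∃ Φ : traceClass H →ₗ[ℂ] traceClass K, IsQuantumChannel Φ ∧ IsCovariant U V Φ ∧ Φ ρ = σ

/-- `G`-equivalence: convertibility by `G`-covariant channels in both directions. -/
def GEquivalent (U : UnitaryRep G H) (V : UnitaryRep G K)
    (ρ : traceClass H) (σ : traceClass K) : Prop :=
  CovariantlyConvertible U V ρ σ ∧ CovariantlyConvertible V U σ ρ

/-- The characteristic function `χ_ψ(g) = ⟨ψ|U(g)|ψ⟩`. -/
def charFunction (U : UnitaryRep G H) (ψ : H) (g : G) : ℂ :=
  ⟪ψ, U.op g ψ⟫_ℂ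

end Symmetry

end Asymmetry

end

open Asymmetry

/-! Sufficiency: if `χ_ψ = χ_φ η`, the orbits `U(g)ψ` and `η(g)V(g)φ` have the same Gram matrix, so
a partial isometry `W`, supported on the closed span `M` of the first orbit, maps one to the other
(`exists_intertwiner`). With `Q` the projection onto `Mᗮ` and `τ` an invariant state on `K`, which
compactness supplies (`exists_invariant_state`), `A ↦ W A W† + tr(Q A Q) τ` is a covariant channel:
the phase `η` cancels in `W A W†`. The reverse conversion uses `η⁻¹`.

Necessity: complete positivity forces a covariant channel taking `ψ` to `φ` to send `|U(g)ψ⟩⟨U(k)ψ|`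
to a multiple of `|V(g)φ⟩⟨V(k)φ|`. By covariance the factor is `f(k⁻¹g)` with `f` positive definite
and `f(1) = 1`; comparing traces gives `χ_ψ = χ_φ f`. The reverse channel gives `χ_φ = χ_ψ f'`. Both
multipliers are bounded by 1 and `f f' = 1` where `χ_ψ ≠ 0`, so `|f| = 1` there. The set `|f| = 1`
is a subgroup on which `f` is multiplicative, and it is all of `G` when `χ_ψ` has no zeros, or when
`G` is connected, since it contains a neighbourhood of 1. -/

namespace Asymmetry

/-! ### Trace functional and rank-one operators -/

section Trace

variable {H K : Type*}
  [NormedAddCommGroup H] [InnerProductSpace ℂ H] [CompleteSpace H]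
  [NormedAddCommGroup K] [InnerProductSpace ℂ K] [CompleteSpace K]

theorem IsNuclearExpansion.trace_eq {A : H →L[ℂ] H} {x y : ℕ → H}
    (h : IsNuclearExpansion A x y) : trace A = ∑' n, ⟪y n, x n⟫_ℂ :=
  (h.hasSum_diagonal _).tsum_eq

omit [CompleteSpace H] in
theorem IsNuclearExpansion.summable_inner {A : H →L[ℂ] H} {x y : ℕ → H}
    (h : IsNuclearExpansion A x y) : Summable fun n => ⟪y n, x n⟫_ℂ :=
  Summable.of_norm_bounded h.summable fun n => by
    rw [mul_comm]; exact norm_inner_le_norm _ _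

theorem IsNuclearExpansion.conj {A : H →L[ℂ] H} {x y : ℕ → H}
    (h : IsNuclearExpansion A x y) (T : H →L[ℂ] K) :
    IsNuclearExpansion (T ∘L A ∘L ContinuousLinearMap.adjoint T)
      (fun n => T (x n)) (fun n => T (y n)) where
  summable := by
    refine Summable.of_nonneg_of_le (fun n => by positivity) (fun n => ?_)
      (h.summable.mul_left (‖T‖ * ‖T‖))
    calc ‖T (x n)‖ * ‖T (y n)‖ ≤ (‖T‖ * ‖x n‖) * (‖T‖ * ‖y n‖) := by
          gcongr <;> exact T.le_opNorm _
      _ = ‖T‖ * ‖T‖ * (‖x n‖ * ‖y n‖) := by ring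
  hasSum v := by
    have h := (h.hasSum (ContinuousLinearMap.adjoint T v)).mapL T
    simpa [ContinuousLinearMap.adjoint_inner_right] using h

theorem hasSum_trace (A : traceClass H) :
    HasSum (fun i => ⟪(exists_hilbertBasis ℂ H).choose_spec.choose i,
      (A : H →L[ℂ] H) ((exists_hilbertBasis ℂ H).choose_spec.choose i)⟫_ℂ)
      (trace (A : H →L[ℂ] H)) := by
  obtain ⟨x, y, h⟩ := A.2
  exact (h.hasSum_diagonal _).summable.hasSum

theorem trace_add (A B : traceClass H) :
    trace ((A + B : traceClass H) : H →L[ℂ] H) = trace (A : H →L[ℂ] H) + trace (B : H →L[ℂ] H) := by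
  refine (hasSum_trace (A + B)).unique ?_
  simpa [inner_add_right] using (hasSum_trace A).add (hasSum_trace B)

theorem trace_smul (c : ℂ) (A : traceClass H) :
    trace ((c • A : traceClass H) : H →L[ℂ] H) = c * trace (A : H →L[ℂ] H) := by
  refine (hasSum_trace (c • A)).unique ?_
  simpa [inner_smul_right] using (hasSum_trace A).mul_left c

variable (H) in
/-- The trace as a linear functional on the trace class operators. -/
noncomputable def traceLM : traceClass H →ₗ[ℂ] ℂ where
  toFun A := trace (A : H →L[ℂ] H)
  map_add' := trace_add
  map_smul' := trace_smul

@[simp]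
theorem traceLM_apply (A : traceClass H) : traceLM H A = trace (A : H →L[ℂ] H) := rfl

/-- `|x⟩⟨y|` as a trace class operator. -/
noncomputable def ketBra (x y : H) : traceClass H :=
  ⟨InnerProductSpace.rankOne ℂ x y, IsTraceClass.rankOne x y⟩

omit [CompleteSpace H] in
@[simp]
theorem coe_ketBra (x y : H) :
    (ketBra x y : H →L[ℂ] H) = InnerProductSpace.rankOne ℂ x y := rfl

theorem trace_ketBra (x y : H) : trace (ketBra x y : H →L[ℂ] H) = ⟪y, x⟫_ℂ := by
  refine (hasSum_trace _).unique ?_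
  simpa [inner_smul_right] using
    (exists_hilbertBasis ℂ H).choose_spec.choose.hasSum_inner_mul_inner y x

theorem conjBy_ketBra (T : H →L[ℂ] H) (x y : H) :
    conjBy T (ketBra x y) = ketBra (T x) (T y) := by
  ext v
  simp [conjBy, ketBra, ContinuousLinearMap.adjoint_inner_right]

omit [CompleteSpace H] in
theorem isPositiveBlock_ketBra {n : ℕ} (x : Fin n → H) :
    IsPositiveBlock fun i j => ketBra (x i) (x j) := by
  intro v
  have : ∑ i, ∑ j, ⟪v i, (ketBra (x i) (x j) : H →L[ℂ] H) (v j)⟫_ℂ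
      = star (∑ i, ⟪x i, v i⟫_ℂ) * ∑ j, ⟪x j, v j⟫_ℂ := by
    simp only [coe_ketBra, InnerProductSpace.rankOne_apply, inner_smul_right, star_sum,
      Finset.sum_mul_sum]
    refine Finset.sum_congr rfl fun i _ => Finset.sum_congr rfl fun j _ => ?_
    rw [← inner_conj_symm (v i) (x i)]
    exact mul_comm _ _
  rw [this]
  exact star_mul_self_nonneg _

end Trace

/-! ### Unitary representations -/

section Rep

variable {G H : Type*} [Group G] [TopologicalSpace G]
  [NormedAddCommGroup H] [InnerProductSpace ℂ H] [CompleteSpace H]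

namespace UnitaryRep

variable (U : UnitaryRep G H)

theorem op_mul (g h : G) : U.op (g * h) = U.op g ∘L U.op h := by
  simp [op, ContinuousLinearMap.mul_def]

theorem op_mul_apply (g h : G) (v : H) : U.op (g * h) v = U.op g (U.op h v) := by
  simp [op_mul]

@[simp]
theorem op_one_apply (v : H) : U.op 1 v = v := by
  simp [op]

theorem adjoint_op (g : G) : ContinuousLinearMap.adjoint (U.op g) = U.op g⁻¹ := by
  simp only [op, map_inv]
  rfl

theorem inner_op_left (g : G) (v w : H) : ⟪U.op g v, w⟫_ℂ = ⟪v, U.op g⁻¹ w⟫_ℂ := by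
  rw [← adjoint_op, ContinuousLinearMap.adjoint_inner_right]

theorem inner_op_op (g h : G) (v w : H) : ⟪U.op g v, U.op h w⟫_ℂ = ⟪v, U.op (g⁻¹ * h) w⟫_ℂ := by
  rw [inner_op_left, op_mul_apply]

@[simp]
theorem norm_op_apply (g : G) (v : H) : ‖U.op g v‖ = ‖v‖ := by
  have := U.inner_op_op g g v v
  rw [inv_mul_cancel, op_one_apply, inner_self_eq_norm_sq_to_K, inner_self_eq_norm_sq_to_K] at this
  have h2 : ‖U.op g v‖ ^ 2 = ‖v‖ ^ 2 := by exact_mod_cast this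
  exact (pow_left_inj₀ (norm_nonneg _) (norm_nonneg _) two_ne_zero).1 h2

theorem op_inv_apply_op_apply (g : G) (v : H) : U.op g⁻¹ (U.op g v) = v := by
  rw [← op_mul_apply, inv_mul_cancel, op_one_apply]

theorem op_apply_op_inv_apply (g : G) (v : H) : U.op g (U.op g⁻¹ v) = v := by
  rw [← op_mul_apply, mul_inv_cancel, op_one_apply]

theorem continuous_op_apply (v : H) : Continuous fun g => U.op g v := U.continuous_apply v

end UnitaryRep

theorem continuous_charFunction (U : UnitaryRep G H) (ψ : H) : Continuous (charFunction U ψ) :=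
  continuous_const.inner (U.continuous_op_apply ψ)

theorem charFunction_one (U : UnitaryRep G H) {ψ : H} (hψ : ‖ψ‖ = 1) : charFunction U ψ 1 = 1 := by
  simp [charFunction, inner_self_eq_norm_sq_to_K, hψ]

end Rep

/-! ### Scalar positivity tests -/

section Scalars

theorem eq_zero_of_forall_real_affine_nonneg {C a : ℂ} (h : ∀ t : ℝ, 0 ≤ C + t * a) : a = 0 := by
  simp only [Complex.nonneg_iff, Complex.add_re, Complex.add_im, Complex.re_ofReal_mul,
    Complex.im_ofReal_mul] at h
  have hre : a.re = 0 := by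
    by_contra hne
    -- This `t` makes the real part equal to -1.
    have := (h (-(C.re + 1) / a.re)).1
    rw [div_mul_cancel₀ _ hne] at this
    linarith
  have h0 := (h 0).2
  have h1 := (h 1).2
  exact Complex.ext hre (by simp only [Complex.zero_im]; linarith)

theorem eq_zero_of_forall_real_quadratic_nonneg {a : ℂ} (h : ∀ t : ℝ, 0 ≤ (t : ℂ) * t + t * a) :
    a = 0 := by
  simp only [Complex.nonneg_iff, Complex.add_re, Complex.add_im, Complex.re_ofReal_mul,
    Complex.im_ofReal_mul, Complex.ofReal_re, Complex.ofReal_im] at h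
  have hre := (h (-a.re / 2)).1
  have him := (h 1).2
  refine Complex.ext ?_ (by simp only [Complex.zero_im]; linarith)
  simp only [Complex.zero_re]
  nlinarith [sq_nonneg a.re]

/-- Polarization: the two hypotheses are what the tests `s = t` and `s = t * I` with real `t` yield
for `star s * a + s * b`. -/
theorem eq_zero_of_add_eq_zero_of_I_mul {a b : ℂ} (h₁ : a + b = 0)
    (h₂ : Complex.I * (b - a) = 0) : a = 0 := by
  have h₃ : b - a = 0 := (mul_eq_zero.1 h₂).resolve_left Complex.I_ne_zero
  linear_combination (h₁ - h₃) / 2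

theorem eq_zero_of_forall_affine_nonneg {C a b : ℂ} (h : ∀ s : ℂ, 0 ≤ C + star s * a + s * b) :
    a = 0 := by
  refine eq_zero_of_add_eq_zero_of_I_mul (b := b)
    (eq_zero_of_forall_real_affine_nonneg (C := C) fun t => ?_)
    (eq_zero_of_forall_real_affine_nonneg (C := C) fun t => ?_)
  · convert h t using 1
    simp; ring
  · convert h (t * Complex.I) using 1
    simp; ring

theorem eq_zero_of_forall_quadratic_nonneg {a b : ℂ}
    (h : ∀ s : ℂ, 0 ≤ star s * s + star s * a + s * b) : a = 0 := by
  refine eq_zero_of_add_eq_zero_of_I_mul (b := b)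
    (eq_zero_of_forall_real_quadratic_nonneg fun t => ?_)
    (eq_zero_of_forall_real_quadratic_nonneg fun t => ?_)
  · convert h t using 1
    simp; ring
  · convert h (t * Complex.I) using 1
    simp; linear_combination ((t : ℂ) * t) * Complex.I_sq

end Scalars

/-! ### Positive blocks with rank-one diagonal -/

section RankOneBlocks

variable {K : Type*} [NormedAddCommGroup K] [InnerProductSpace ℂ K]

/-- A positive `2 × 2` block operator with diagonal `|x⟩⟨x|`, `|y⟩⟨y|` has a multiple of `|x⟩⟨y|` in
its corner. -/
theorem IsPositiveBlock.eq_smul_ketBra {A : Fin 2 → Fin 2 → traceClass K} (hA : IsPositiveBlock A)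
    {x y : K} (hx : ‖x‖ = 1) (hy : ‖y‖ = 1) (h₀ : A 0 0 = ketBra x x) (h₁ : A 1 1 = ketBra y y) :
    A 0 1 = ⟪x, (A 0 1 : K →L[ℂ] K) y⟫_ℂ • ketBra x y := by
  have key : ∀ v w : K, 0 ≤ star ⟪x, v⟫_ℂ * ⟪x, v⟫_ℂ + ⟪v, (A 0 1 : K →L[ℂ] K) w⟫_ℂ
      + (⟪w, (A 1 0 : K →L[ℂ] K) v⟫_ℂ + star ⟪y, w⟫_ℂ * ⟪y, w⟫_ℂ) := by
    intro v w
    have := hA ![v, w]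
    simpa [Fin.sum_univ_two, h₀, h₁, inner_smul_right, mul_comm] using this
  -- For `v ⊥ x` the form at `(s • v, w)` has no quadratic term in `s`, so nonnegativity for all `s`
  -- kills the cross term.
  have left : ∀ v w : K, ⟪x, v⟫_ℂ = 0 → ⟪v, (A 0 1 : K →L[ℂ] K) w⟫_ℂ = 0 := by
    intro v w hv
    refine eq_zero_of_forall_affine_nonneg (C := star ⟪y, w⟫_ℂ * ⟪y, w⟫_ℂ)
      (b := ⟪w, (A 1 0 : K →L[ℂ] K) v⟫_ℂ) fun s => ?_
    have := key (s • v) w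
    simp only [inner_smul_right, inner_smul_left, hv, map_smul] at this
    convert this using 1
    simp; ring
  have right : ∀ v w : K, ⟪y, w⟫_ℂ = 0 → ⟪v, (A 0 1 : K →L[ℂ] K) w⟫_ℂ = 0 := by
    intro v w hw
    refine eq_zero_of_forall_affine_nonneg (C := star ⟪x, v⟫_ℂ * ⟪x, v⟫_ℂ)
      (b := ⟪w, (A 1 0 : K →L[ℂ] K) v⟫_ℂ) fun s => ?_
    have := key v (star s • w)
    simp only [inner_smul_right, inner_smul_left, hw, map_smul] at this
    convert this using 1
    simp
  have hxx : ⟪x, x⟫_ℂ = 1 := by simp [inner_self_eq_norm_sq_to_K, hx]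
  have hyy : ⟪y, y⟫_ℂ = 1 := by simp [inner_self_eq_norm_sq_to_K, hy]
  ext w
  refine ext_inner_left ℂ fun v => ?_
  -- Only the components of `v` along `x` and of `w` along `y` contribute to the corner.
  have hl := left (v - ⟪x, v⟫_ℂ • x) w (by
    rw [inner_sub_right, inner_smul_right, hxx, mul_one, sub_self])
  have hr := right x (w - ⟪y, w⟫_ℂ • y) (by
    rw [inner_sub_right, inner_smul_right, hyy, mul_one, sub_self])
  simp only [inner_sub_left, inner_smul_left, map_sub, map_smul, inner_sub_right,
    inner_smul_right, inner_conj_symm] at hl hr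
  simp only [Submodule.coe_smul, smul_apply, coe_ketBra,
    InnerProductSpace.rankOne_apply, inner_smul_right]
  linear_combination hl + ⟪v, x⟫_ℂ * hr

end RankOneBlocks

/-! ### Positive definite functions on a group -/

section PositiveDefinite

variable {G : Type*} [Group G]

/-- A normalized positive definite function on a group. -/
structure IsNormalizedPosDef (f : G → ℂ) : Prop where
  map_one : f 1 = 1
  nonneg : ∀ (n : ℕ) (g : Fin n → G) (a : Fin n → ℂ),
    0 ≤ ∑ i, ∑ j, star (a i) * a j * f ((g j)⁻¹ * g i)

namespace IsNormalizedPosDef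

variable {f : G → ℂ} (hf : IsNormalizedPosDef f)

include hf

theorem nonneg_two (g : G) (s : ℂ) :
    0 ≤ 1 + star s * s + star s * f g + s * f g⁻¹ := by
  have := hf.nonneg 2 ![g, 1] ![s, 1]
  simp only [Fin.sum_univ_two, Matrix.cons_val_zero, Matrix.cons_val_one, inv_mul_cancel,
    hf.map_one, inv_one, one_mul, mul_one, star_one] at this
  convert this using 1
  ring

theorem map_inv (g : G) : f g⁻¹ = star (f g) := by
  have h₁ := (Complex.nonneg_iff.1 (hf.nonneg_two g 1)).2
  have h₂ := (Complex.nonneg_iff.1 (hf.nonneg_two g Complex.I)).2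
  simp at h₁ h₂
  apply Complex.ext <;> simp <;> linarith

theorem norm_le_one (g : G) : ‖f g‖ ≤ 1 := by
  -- The minimizing `s`: the form becomes `1 - |f g|²`.
  have h := hf.nonneg_two g (-f g)
  rw [hf.map_inv] at h
  have e : 1 + star (-f g) * -f g + star (-f g) * f g + -f g * star (f g)
      = ((1 - ‖f g‖ ^ 2 : ℝ) : ℂ) := by
    have := Complex.mul_conj' (f g)
    simp only [star_neg, Complex.star_def]
    push_cast
    linear_combination -this
  rw [e, Complex.zero_le_real] at h
  nlinarith [norm_nonneg (f g)]

/-- Think of `f(k⁻¹g)` as `⟨v_k, v_g⟩` for unit vectors. If `|f g| = 1`, equality in Cauchy–Schwarz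
gives `v_1 = f(g) v_{g⁻¹}`, and pairing with `v_h` gives the claim. In the proof the coefficients at
`1` and `g⁻¹` form this null combination, so the form in `s` has no constant term and its cross term
must vanish. -/
theorem map_mul_of_norm_eq_one {g : G} (hg : ‖f g‖ = 1) (h : G) : f (g * h) = f g * f h := by
  have hgg : f g * star (f g) = 1 := by
    rw [Complex.star_def, Complex.mul_conj', hg]; simp
  have hz : f h - star (f g) * f (g * h) = 0 := by
    refine eq_zero_of_forall_quadratic_nonneg (b := star (f h) - f g * star (f (g * h)))
      fun s => ?_
    have := hf.nonneg 3 ![h, 1, g⁻¹] ![s, 1, -star (f g)]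
    simp only [Fin.sum_univ_three, Matrix.cons_val, inv_mul_cancel, hf.map_one, inv_one, one_mul,
      mul_one, star_one, inv_inv, star_neg, star_star, hf.map_inv, ← mul_inv_rev,
      mul_inv_cancel] at this
    convert this using 1
    linear_combination hgg
  linear_combination (f (g * h)) * hgg.symm - f g * hz

/-- The subgroup on which a normalized positive definite function has modulus one. -/
def unimodularSubgroup : Subgroup G where
  carrier := {g | ‖f g‖ = 1}
  one_mem' := by simp [hf.map_one]
  mul_mem' {a b} ha hb := by
    have ha : ‖f a‖ = 1 := ha
    have hb : ‖f b‖ = 1 := hb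
    simp [hf.map_mul_of_norm_eq_one ha, ha, hb]
  inv_mem' {a} ha := by
    have ha : ‖f a‖ = 1 := ha
    simp [hf.map_inv, ha]

end IsNormalizedPosDef

end PositiveDefinite

/-! ### From equivalence to a character -/

section Converse

variable {G H K : Type*} [Group G] [TopologicalSpace G]
  [NormedAddCommGroup H] [InnerProductSpace ℂ H] [CompleteSpace H]
  [NormedAddCommGroup K] [InnerProductSpace ℂ K] [CompleteSpace K]
  {U : UnitaryRep G H} {V : UnitaryRep G K} {ψ : H} {φ : K}

/-- The multiplier `f` is the factor `c g 1` by which the channel scales the coherence between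
`U(g)ψ` and `ψ`; positive definiteness is complete positivity tested on the orbit of `φ`. -/
theorem CovariantlyConvertible.exists_isNormalizedPosDef
    (h : CovariantlyConvertible U V (pureState ψ) (pureState φ)) (hφ : ‖φ‖ = 1) :
    ∃ f : G → ℂ, IsNormalizedPosDef f ∧ ∀ g, charFunction U ψ g = charFunction V φ g * f g := by
  obtain ⟨Φ, hΦ, hcov, hst⟩ := h
  set M : G → G → traceClass K := fun g k => Φ (ketBra (U.op g ψ) (U.op k ψ)) with hM
  set c : G → G → ℂ := fun g k => ⟪V.op g φ, (M g k : K →L[ℂ] K) (V.op k φ)⟫_ℂ with hc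
  have hblock : ∀ (n : ℕ) (g : Fin n → G), IsPositiveBlock fun i j => M (g i) (g j) :=
    fun n g => hΦ.completelyPositive n _ (isPositiveBlock_ketBra fun i => U.op (g i) ψ)
  have hcovM : ∀ k g g', M (k * g) (k * g') = conjBy (V.op k) (M g g') := fun k g g' => by
    simp only [hM, ← hcov k, conjBy_ketBra, U.op_mul_apply]
  have hdiag : ∀ g, M g g = ketBra (V.op g φ) (V.op g φ) := fun g => by
    have h1 : M 1 1 = ketBra φ φ := by
      simp only [hM, U.op_one_apply]
      exact hst
    rw [← conjBy_ketBra, ← h1, ← hcovM, mul_one]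
  have hoff : ∀ g k, M g k = c g k • ketBra (V.op g φ) (V.op k φ) := fun g k =>
    (hblock 2 ![g, k]).eq_smul_ketBra (by simp [hφ]) (by simp [hφ]) (hdiag g) (hdiag k)
  have hinv : ∀ k g g', c (k * g) (k * g') = c g g' := fun k g g' => by
    simp only [hc, hcovM, conjBy, V.op_mul_apply, ContinuousLinearMap.comp_apply, V.adjoint_op,
      V.op_inv_apply_op_apply]
    rw [V.inner_op_left, V.op_inv_apply_op_apply]
  have hc1 : ∀ g k, c g k = c (k⁻¹ * g) 1 := fun g k => by
    rw [← hinv k⁻¹ g k, inv_mul_cancel]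
  refine ⟨fun g => c g 1, ⟨?_, fun n g a => ?_⟩, fun g => ?_⟩
  · simp [hc, hdiag, inner_self_eq_norm_sq_to_K, hφ]
  · have := hblock n g fun i => a i • V.op (g i) φ
    convert this using 4 with i _ j _
    rw [← hc1]
    simp only [map_smul, inner_smul_left, inner_smul_right, hc, Complex.star_def]
    ring
  -- Both sides of the trace identity are inner products: `χ_ψ(g)` before the channel and `f(g)
  -- χ_φ(g)` after it.
  · have ht := hΦ.tracePreserving (ketBra (U.op g ψ) (U.op 1 ψ))
    have hoff' := hoff g 1
    simp only [hM] at hoff'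
    rw [hoff', trace_smul, trace_ketBra, trace_ketBra, U.op_one_apply, V.op_one_apply] at ht
    rw [charFunction, charFunction, ← ht, mul_comm]

theorem GEquivalent.exists_character [IsTopologicalGroup G]
    (h : GEquivalent U V (pureState ψ) (pureState φ)) (hψ : ‖ψ‖ = 1) (hφ : ‖φ‖ = 1)
    (hG : ConnectedSpace G ∨ ∀ g, charFunction U ψ g ≠ 0) :
    ∃ η : G →ₜ* Circle, ∀ g, charFunction U ψ g = charFunction V φ g * (η g : ℂ) := by
  obtain ⟨f, hf, hfe⟩ := h.1.exists_isNormalizedPosDef hφ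
  obtain ⟨f', hf', hfe'⟩ := h.2.exists_isNormalizedPosDef hψ
  have hunim : ∀ g, charFunction U ψ g ≠ 0 → g ∈ hf.unimodularSubgroup := fun g hg => by
    have h1 : f' g * f g = 1 := by
      have := hfe g
      rw [hfe' g, mul_assoc] at this
      exact (mul_eq_left₀ hg).1 this.symm
    have h2 : ‖f' g‖ * ‖f g‖ = 1 := by rw [← norm_mul, h1, norm_one]
    refine le_antisymm (hf.norm_le_one g) ?_
    calc (1 : ℝ) = ‖f' g‖ * ‖f g‖ := h2.symm
      _ ≤ 1 * ‖f g‖ := by gcongr; exact hf'.norm_le_one g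
      _ = ‖f g‖ := one_mul _
  have htop : hf.unimodularSubgroup = ⊤ := by
    rcases hG with hG | hG
    -- The subgroup contains the neighbourhood of 1 where `χ_ψ ≠ 0`, so it is open, hence closed,
    -- hence everything.
    · have hopen : IsOpen (hf.unimodularSubgroup : Set G) := by
        refine Subgroup.isOpen_of_mem_nhds _ (g := 1) ?_
        have : {g | charFunction U ψ g ≠ 0} ∈ nhds (1 : G) :=
          (isOpen_ne.preimage (continuous_charFunction U ψ)).mem_nhds
            (by simp [charFunction_one U hψ])
        exact Filter.mem_of_superset this hunim
      have hclopen : IsClopen (hf.unimodularSubgroup : Set G) :=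
        ⟨Subgroup.isClosed_of_isOpen _ hopen, hopen⟩
      rw [← SetLike.coe_set_eq, Subgroup.coe_top]
      exact hclopen.eq_univ ⟨1, one_mem _⟩
    · exact eq_top_iff.2 fun g _ => hunim g (hG g)
  have hnorm : ∀ g, ‖f g‖ = 1 := fun g => by
    have : g ∈ hf.unimodularSubgroup := htop ▸ Subgroup.mem_top g
    exact this
  let η : G →* Circle :=
    { toFun := fun g => ⟨f g, mem_sphere_zero_iff_norm.2 (hnorm g)⟩
      map_one' := Circle.ext hf.map_one
      map_mul' := fun g k => Circle.ext (hf.map_mul_of_norm_eq_one (hnorm g) k) }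
  -- Positive definiteness includes no continuity; near 1, however, `f` is the quotient `χ_ψ / χ_φ`,
  -- and continuity at 1 suffices for a homomorphism.
  have hcont : Continuous η := by
    refine continuous_of_continuousAt_one η ?_
    have hind : Topology.IsInducing fun z : Circle => (z : ℂ) := ⟨rfl⟩
    rw [hind.continuousAt_iff]
    have hne : charFunction V φ 1 ≠ 0 := by simp [charFunction_one V hφ]
    have hq : ContinuousAt (fun g => charFunction U ψ g / charFunction V φ g) 1 :=
      (continuous_charFunction U ψ).continuousAt.div (continuous_charFunction V φ).continuousAt hne
    refine hq.congr ?_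
    filter_upwards [(continuous_charFunction V φ).continuousAt.eventually_ne hne] with g hg
    rw [hfe g, mul_div_cancel_left₀ _ hg]
    rfl
  exact ⟨⟨η, hcont⟩, hfe⟩

end Converse

/-! ### Finite-dimensional invariant subspaces and invariant states -/

section InvariantSubspaces

variable {G K : Type*} [Group G] [TopologicalSpace G]
  [NormedAddCommGroup K] [InnerProductSpace ℂ K] [CompleteSpace K]

/-- By unitarity `Fᗮ` is invariant too, because `g⁻¹` preserves `F`. -/
theorem UnitaryRep.starProjection_op_apply (V : UnitaryRep G K) (F : Submodule ℂ K)
    [F.HasOrthogonalProjection] (hF : ∀ g, ∀ v ∈ F, V.op g v ∈ F) (g : G) (v : K) :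
    F.starProjection (V.op g v) = V.op g (F.starProjection v) := by
  refine Submodule.eq_starProjection_of_mem_orthogonal
    (hF g _ (Submodule.starProjection_apply_mem F v)) ?_
  rw [← map_sub, Submodule.mem_orthogonal]
  intro u hu
  have h := Submodule.inner_right_of_mem_orthogonal (hF g⁻¹ u hu)
    (F.sub_starProjection_mem_orthogonal v)
  rwa [V.inner_op_left, inv_inv] at h

open MeasureTheory in
/-- A unitary representation of a compact group on a nonzero Hilbert space has a nonzero
finite-dimensional invariant subspace, namely an eigenspace of the Haar average of a projection of
rank one. -/
theorem UnitaryRep.exists_finiteDimensional_invariant [IsTopologicalGroup G] [CompactSpace G]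
    (V : UnitaryRep G K) [Nontrivial K] :
    ∃ F : Submodule ℂ K, FiniteDimensional ℂ F ∧ F ≠ ⊥ ∧ ∀ g, ∀ v ∈ F, V.op g v ∈ F := by
  obtain ⟨φ, hφ⟩ := exists_ne (0 : K)
  borelize G
  let C₀ : TopologicalSpace.PositiveCompacts G := ⊤
  let μ : Measure G := Measure.haarMeasure C₀
  have hprob : IsProbabilityMeasure μ :=
    ⟨by simpa [C₀] using Measure.haarMeasure_self (K₀ := C₀)⟩
  let p : G → K →L[ℂ] K := fun g => InnerProductSpace.rankOne ℂ (V.op g φ) (V.op g φ)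
  have hV := V.continuous_op_apply φ
  -- Strong continuity of `V` gives norm continuity of these rank-one operators, so the average
  -- exists in operator norm, where compact operators are closed.
  have hpc : Continuous p :=
    (ContinuousLinearMap.smulRightL ℂ K K).continuous₂.comp
      (((innerSL ℂ).continuous.comp hV).prodMk hV)
  have hpi : Integrable p μ :=
    hpc.integrable_of_hasCompactSupport (HasCompactSupport.of_compactSpace _)
  let T : K →L[ℂ] K := ∫ g, p g ∂μ
  have hT : ∀ w, T w = ∫ g, p g w ∂μ := fun w => ContinuousLinearMap.integral_apply hpi w
  have hpw : ∀ w, Integrable (fun g => p g w) μ := fun w => hpi.apply_continuousLinearMap w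
  have hcomm : ∀ h w, T (V.op h w) = V.op h (T w) := fun h w => by
    rw [hT, hT, ← ContinuousLinearMap.integral_comp_comm _ (hpw w),
      ← integral_mul_left_eq_self _ h]
    congr 1 with g
    simp only [p, InnerProductSpace.rankOne_apply, V.op_mul_apply, map_smul]
    rw [V.inner_op_left h, V.op_inv_apply_op_apply]
  have hcompact : IsCompactOperator T := by
    have hmem : T ∈ (compactOperator (RingHom.id ℂ) K K : Set (K →L[ℂ] K)) := by
      refine Convex.integral_mem ((compactOperator (RingHom.id ℂ) K K).restrictScalars ℝ).convex
        isClosed_setOfPred_isCompactOperator (Filter.Eventually.of_forall fun g => ?_) hpi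
      exact (isCompactOperator_of_locallyCompactSpace_dom
        (innerSL ℂ (V.op g φ))).clm_comp (.toSpanSingleton ℂ (V.op g φ))
    exact hmem
  have hsymm : (T : K →L[ℂ] K).IsSymmetric := by
    have hmem : T ∈ (selfAdjoint (K →L[ℂ] K) : Set (K →L[ℂ] K)) := by
      refine Convex.integral_mem (selfAdjoint.submodule ℝ (K →L[ℂ] K)).convex
        (isClosed_eq continuous_star continuous_id) (Filter.Eventually.of_forall fun g => ?_) hpi
      exact (InnerProductSpace.isPositive_rankOne_self _).isSelfAdjoint
    exact (ContinuousLinearMap.isSelfAdjoint_iff_isSymmetric.1 hmem)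
  have hne : T ≠ 0 := by
    intro h0
    -- The integrand is continuous, nonnegative and nonzero at `g = 1`.
    have h1 : ⟪φ, T φ⟫_ℂ = ((∫ g, ‖⟪φ, V.op g φ⟫_ℂ‖ ^ 2 ∂μ : ℝ) : ℂ) := by
      rw [hT, ← integral_inner (hpw φ), ← integral_complex_ofReal]
      congr 1 with g
      simp only [p, InnerProductSpace.rankOne_apply, inner_smul_right]
      rw [← inner_conj_symm (V.op g φ) φ, Complex.conj_mul']
      simp
    have h2 : 0 < ∫ g, ‖⟪φ, V.op g φ⟫_ℂ‖ ^ 2 ∂μ := by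
      refine Continuous.integral_pos_of_hasCompactSupport_nonneg_nonzero (x := 1)
        (((continuous_const.inner hV).norm).pow 2) (HasCompactSupport.of_compactSpace _)
        (fun g => by positivity) ?_
      simpa using hφ
    rw [h0] at h1
    simp only [zero_apply, inner_zero_right] at h1
    exact h2.ne (by exact_mod_cast h1)
  have := mt (ContinuousLinearMap.eq_zero_of_forall_hasEigenvalue_eq_zero hcompact hsymm).1 hne
  push Not at this
  obtain ⟨c, hc, hc0⟩ := this
  refine ⟨Module.End.eigenspace T.toLinearMap c,
    ContinuousLinearMap.finite_dimensional_eigenspace hcompact c hc0, hc, fun g v hv => ?_⟩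
  rw [Module.End.mem_eigenspace_iff] at hv ⊢
  have hv : T v = c • v := hv
  change T (V.op g v) = c • V.op g v
  rw [hcomm, hv, map_smul]

/-- A state on `K` commuting with a representation of a compact group: the normalized projection
onto an invariant finite-dimensional subspace. -/
theorem UnitaryRep.exists_invariant_state [IsTopologicalGroup G] [CompactSpace G]
    (V : UnitaryRep G K) [Nontrivial K] :
    ∃ τ : traceClass K, trace (τ : K →L[ℂ] K) = 1 ∧ (∀ g, conjBy (V.op g) τ = τ) ∧
      ∃ (m : ℕ) (f : Fin m → K), τ = ∑ k, ketBra (f k) (f k) := by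
  obtain ⟨F, hFfin, hF0, hF⟩ := V.exists_finiteDimensional_invariant
  let b := stdOrthonormalBasis ℂ F
  let d := Module.finrank ℂ F
  have hd : d ≠ 0 := fun h => hF0 (Submodule.finrank_eq_zero.1 h)
  -- The factor `1 / d` is split between ket and bra, so that `τ` is visibly a sum of `|f⟩⟨f|`, as
  -- complete positivity will need.
  let r : ℂ := ((√d : ℝ) : ℂ)⁻¹
  have hr : r * star r = (d : ℂ)⁻¹ := by
    simp only [r, Complex.star_def, map_inv₀, Complex.conj_ofReal, ← mul_inv]
    congr 1
    exact_mod_cast Real.mul_self_sqrt (Nat.cast_nonneg d)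
  let τ : traceClass K := ∑ k, ketBra (r • (b k : K)) (r • (b k : K))
  have hτ : (τ : K →L[ℂ] K) = (d : ℂ)⁻¹ • F.starProjection := by
    rw [b.starProjection_eq_sum_rankOne, Finset.smul_sum, ← hr]
    simp [τ, smul_smul]
  refine ⟨τ, ?_, fun g => ?_, _, _, rfl⟩
  · have h1 : ∀ k, ⟪(b k : K), (b k : K)⟫_ℂ = 1 := fun k => by
      rw [inner_self_eq_norm_sq_to_K, ← Submodule.coe_norm, b.norm_eq_one]; simp
    rw [← traceLM_apply, map_sum]
    simp only [traceLM_apply, trace_ketBra, inner_smul_left, inner_smul_right, h1, mul_one]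
    rw [Finset.sum_const, Finset.card_univ, Fintype.card_fin, ← Complex.star_def, hr, nsmul_eq_mul]
    exact mul_inv_cancel₀ (by exact_mod_cast hd)
  · ext v
    simp only [conjBy, hτ, ContinuousLinearMap.comp_apply, V.adjoint_op, smul_apply, map_smul,
      V.starProjection_op_apply F hF, V.op_apply_op_inv_apply]

end InvariantSubspaces

/-! ### Partial isometries from equal Gram forms -/

section PartialIsometry

variable {X H K : Type*} [AddCommGroup X] [Module ℂ X]
  [NormedAddCommGroup H] [InnerProductSpace ℂ H] [CompleteSpace H]
  [NormedAddCommGroup K] [InnerProductSpace ℂ K] [CompleteSpace K]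

/-- Two linear maps with the same Gram form differ by a partial isometry. -/
theorem exists_partialIsometry (e : X →ₗ[ℂ] H) (f : X →ₗ[ℂ] K)
    (h : ∀ a b, ⟪f a, f b⟫_ℂ = ⟪e a, e b⟫_ℂ) :
    ∃ W : H →L[ℂ] K, (∀ a, W (e a) = f a) ∧
      ∀ x y, ⟪W x, W y⟫_ℂ = ⟪(LinearMap.range e).topologicalClosure.starProjection x,
        (LinearMap.range e).topologicalClosure.starProjection y⟫_ℂ := by
  set M := (LinearMap.range e).topologicalClosure with hM
  have hmem : ∀ a, e a ∈ M := fun a =>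
    (LinearMap.range e).le_topologicalClosure (LinearMap.mem_range_self e a)
  let e' : X →ₗ[ℂ] M := e.codRestrict M hmem
  have hdense : DenseRange e' := by
    intro m
    rw [closure_subtype]
    have hm : (m : H) ∈ closure (Set.range e) := m.2
    convert hm using 2
    ext x
    simp only [Set.mem_image, Set.mem_range]
    constructor
    · rintro ⟨_, ⟨a, rfl⟩, rfl⟩
      exact ⟨a, rfl⟩
    · rintro ⟨a, rfl⟩
      exact ⟨e' a, ⟨a, rfl⟩, rfl⟩
  -- Equal Gram forms give equal norms, so `f` factors through `e'` and extends from its dense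
  -- range.
  have hnorm : ∀ a, ‖f a‖ ≤ 1 * ‖e' a‖ := fun a => by
    have h1 : ‖f a‖ = ‖e a‖ := by
      rw [@norm_eq_sqrt_re_inner ℂ, @norm_eq_sqrt_re_inner ℂ, h]
    rw [one_mul, h1]
    exact le_rfl
  let T : M →L[ℂ] K := f.extendOfNorm e'
  have hT : ∀ a, T (e' a) = f a := LinearMap.extendOfNorm_eq hdense ⟨1, hnorm⟩
  have hinner : ∀ x y : M, ⟪T x, T y⟫_ℂ = ⟪(x : H), (y : H)⟫_ℂ := fun x y => by
    refine hdense.induction_on₂ (p := fun x y : M => ⟪T x, T y⟫_ℂ = ⟪(x : H), (y : H)⟫_ℂ)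
      ?_ (fun a b => ?_) x y
    · exact isClosed_eq (by fun_prop) (by fun_prop)
    · rw [hT, hT, h]
      rfl
  refine ⟨T ∘L M.orthogonalProjectionOnto, fun a => ?_, fun x y => hinner _ _⟩
  have : M.orthogonalProjectionOnto (e a) = e' a :=
    Submodule.orthogonalProjectionOnto_mem_subspace_eq_self (e' a)
  rw [ContinuousLinearMap.comp_apply, this, hT]

end PartialIsometry

/-! ### The intertwining partial isometry -/

section Intertwiner

variable {G H K : Type*} [Group G] [TopologicalSpace G]
  [NormedAddCommGroup H] [InnerProductSpace ℂ H] [CompleteSpace H]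
  [NormedAddCommGroup K] [InnerProductSpace ℂ K] [CompleteSpace K]

/-- If `χ_ψ = χ_φ η`, then `U(g)ψ ↦ η(g) V(g)φ` extends to a partial isometry which intertwines `U`
with `η V` and is supported on a closed invariant subspace. -/
theorem exists_intertwiner (U : UnitaryRep G H) (V : UnitaryRep G K) (ψ : H) (φ : K)
    (η : G →* Circle) (h : ∀ g, charFunction U ψ g = charFunction V φ g * (η g : ℂ)) :
    ∃ (M : Submodule ℂ H) (_ : M.HasOrthogonalProjection) (W : H →L[ℂ] K), ψ ∈ M ∧ W ψ = φ ∧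
      (∀ g, ∀ v ∈ M, U.op g v ∈ M) ∧ (∀ g, W ∘L U.op g = (η g : ℂ) • (V.op g ∘L W)) ∧
      ∀ x y, ⟪W x, W y⟫_ℂ = ⟪M.starProjection x, M.starProjection y⟫_ℂ := by
  let e : (G →₀ ℂ) →ₗ[ℂ] H := Finsupp.linearCombination ℂ fun g => U.op g ψ
  let f : (G →₀ ℂ) →ₗ[ℂ] K := Finsupp.linearCombination ℂ fun g => (η g : ℂ) • V.op g φ
  have hgen : ∀ g k, ⟪(η g : ℂ) • V.op g φ, (η k : ℂ) • V.op k φ⟫_ℂ = ⟪U.op g ψ, U.op k ψ⟫_ℂ := by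
    intro g k
    have := h (g⁻¹ * k)
    simp only [charFunction] at this
    rw [U.inner_op_op, this, inner_smul_left, inner_smul_right, V.inner_op_op, map_mul, map_inv,
      Circle.coe_mul, Circle.coe_inv_eq_conj]
    ring
  have hgram : ∀ a b, ⟪f a, f b⟫_ℂ = ⟪e a, e b⟫_ℂ := by
    intro a b
    simp only [e, f, Finsupp.linearCombination_apply, Finsupp.sum, sum_inner, inner_sum,
      inner_smul_left _ _ (a _), inner_smul_right _ _ (b _), hgen]
  obtain ⟨W, hWe, hW⟩ := exists_partialIsometry e f hgram
  set M := (LinearMap.range e).topologicalClosure with hM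
  have he1 : ∀ g, e (Finsupp.single g 1) = U.op g ψ := fun g => by simp [e]
  have hf1 : ∀ g, f (Finsupp.single g 1) = (η g : ℂ) • V.op g φ := fun g => by simp [f]
  have hWU : ∀ g, W (U.op g ψ) = (η g : ℂ) • V.op g φ := fun g => by rw [← he1, hWe, hf1]
  have hspan : LinearMap.range e = Submodule.span ℂ (Set.range fun g => U.op g ψ) :=
    Finsupp.range_linearCombination ℂ
  have hMclosed : IsClosed (M : Set H) := Submodule.isClosed_topologicalClosure _
  -- `M` is the least closed subspace containing the orbit, so invariance and intertwining need
  -- checking only on orbit vectors.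
  have hle : ∀ N : Submodule ℂ H, IsClosed (N : Set H) → (∀ g, U.op g ψ ∈ N) → M ≤ N := by
    intro N hN hgN
    refine Submodule.topologicalClosure_minimal _ ?_ hN
    rw [hspan, Submodule.span_le]
    rintro _ ⟨g, rfl⟩
    exact hgN g
  have hUM : ∀ g, U.op g ψ ∈ M := fun g =>
    Submodule.le_topologicalClosure _ (he1 g ▸ LinearMap.mem_range_self e _)
  have hinv : ∀ g, ∀ v ∈ M, U.op g v ∈ M := by
    intro g v hv
    refine hle (M.comap (U.op g).toLinearMap) (hMclosed.preimage (U.op g).continuous)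
      (fun k => ?_) hv
    change U.op g (U.op k ψ) ∈ M
    rw [← U.op_mul_apply]
    exact hUM _
  -- `W` vanishes on `Mᗮ`, which carries the intertwining relation from `M` to all of `H`.
  have hWP : ∀ x, W (M.starProjection x) = W x := by
    intro x
    have hz : W (x - M.starProjection x) = 0 := by
      rw [← inner_self_eq_zero (𝕜 := ℂ), hW, map_sub,
        Submodule.starProjection_eq_self_iff.2 (M.starProjection_apply_mem x), sub_self,
        inner_zero_left]
    rw [map_sub, sub_eq_zero] at hz
    exact hz.symm
  refine ⟨M, inferInstance, W, by simpa using hUM 1, by simpa using hWU 1, hinv, fun g => ?_, hW⟩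
  have hcomm : ∀ v ∈ M, W (U.op g v) = (η g : ℂ) • V.op g (W v) := by
    intro v hv
    refine hle (LinearMap.eqLocus (W ∘L U.op g).toLinearMap
      ((η g : ℂ) • (V.op g ∘L W)).toLinearMap)
      (isClosed_eq (W ∘L U.op g).continuous ((η g : ℂ) • (V.op g ∘L W)).continuous)
      (fun k => ?_) hv
    change W (U.op g (U.op k ψ)) = (η g : ℂ) • V.op g (W (U.op k ψ))
    rw [← U.op_mul_apply, hWU, hWU, map_smul, smul_smul, V.op_mul_apply, map_mul, Circle.coe_mul]
  ext v
  have := hcomm _ (M.starProjection_apply_mem v)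
  rw [← U.starProjection_op_apply M hinv, hWP, hWP] at this
  exact this

end Intertwiner

/-! ### Building blocks of channels -/

section Channel

variable {H K L : Type*}
  [NormedAddCommGroup H] [InnerProductSpace ℂ H] [CompleteSpace H]
  [NormedAddCommGroup K] [InnerProductSpace ℂ K] [CompleteSpace K]
  [NormedAddCommGroup L] [InnerProductSpace ℂ L] [CompleteSpace L]

/-- `A ↦ T A T†` as a linear map between spaces of trace class operators. -/
noncomputable def conjLM (T : H →L[ℂ] K) : traceClass H →ₗ[ℂ] traceClass K where
  toFun A := ⟨T ∘L (A : H →L[ℂ] H) ∘L ContinuousLinearMap.adjoint T, IsTraceClass.conj T A.2⟩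
  map_add' A B := by ext v; simp
  map_smul' c A := by ext v; simp

theorem coe_conjLM_apply (T : H →L[ℂ] K) (A : traceClass H) (v : K) :
    (conjLM T A : K →L[ℂ] K) v = T ((A : H →L[ℂ] H) (ContinuousLinearMap.adjoint T v)) := rfl

theorem conjBy_eq_conjLM (T : H →L[ℂ] H) (A : traceClass H) : conjBy T A = conjLM T A := rfl

theorem conjLM_conjLM (S : K →L[ℂ] L) (T : H →L[ℂ] K) (A : traceClass H) :
    conjLM S (conjLM T A) = conjLM (S ∘L T) A := by
  ext v
  simp [coe_conjLM_apply, ContinuousLinearMap.adjoint_comp]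

/-- The phase meets its conjugate on the other side of `A`. This is why a one-dimensional
representation is invisible to covariance. -/
theorem conjLM_circle_smul (z : Circle) (T : H →L[ℂ] K) (A : traceClass H) :
    conjLM ((z : ℂ) • T) A = conjLM T A := by
  have hadj : ContinuousLinearMap.adjoint ((z : ℂ) • T)
      = star (z : ℂ) • ContinuousLinearMap.adjoint T := map_smulₛₗ _ _ _
  ext v
  simp only [coe_conjLM_apply, hadj, smul_apply, map_smul, smul_smul, Complex.star_def,
    ← Circle.coe_inv_eq_conj, ← Circle.coe_mul, inv_mul_cancel, Circle.coe_one, one_smul]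

theorem conjLM_ketBra (T : H →L[ℂ] K) (x y : H) :
    conjLM T (ketBra x y) = ketBra (T x) (T y) := by
  ext v
  simp [coe_conjLM_apply, ContinuousLinearMap.adjoint_inner_right]

theorem trace_conjLM_of_inner (T : H →L[ℂ] K) (hT : ∀ x y, ⟪T x, T y⟫_ℂ = ⟪x, y⟫_ℂ)
    (A : traceClass H) : trace (conjLM T A : K →L[ℂ] K) = trace (A : H →L[ℂ] H) := by
  obtain ⟨x, y, h⟩ := A.2
  rw [h.trace_eq, ← tsum_congr fun n => hT (y n) (x n)]
  exact (h.conj T).trace_eq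

/-- The hypothesis is the Kraus condition `S†S + T†T = 1` in weak form; it is summed along a nuclear
expansion of `A`. -/
theorem trace_conjLM_add (S : H →L[ℂ] K) (T : H →L[ℂ] L)
    (h : ∀ x y, ⟪S x, S y⟫_ℂ + ⟪T x, T y⟫_ℂ = ⟪x, y⟫_ℂ) (A : traceClass H) :
    trace (conjLM S A : K →L[ℂ] K) + trace (conjLM T A : L →L[ℂ] L) = trace (A : H →L[ℂ] H) := by
  obtain ⟨x, y, hA⟩ := A.2
  have hS := hA.conj S
  have hT := hA.conj T
  rw [hA.trace_eq, ← tsum_congr fun n => h (y n) (x n),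
    hS.summable_inner.tsum_add hT.summable_inner]
  exact congrArg₂ _ hS.trace_eq hT.trace_eq

omit [CompleteSpace H] in
theorem IsPositiveBlock.add {n : ℕ} {A B : Fin n → Fin n → traceClass H}
    (hA : IsPositiveBlock A) (hB : IsPositiveBlock B) :
    IsPositiveBlock fun i j => A i j + B i j := by
  intro v
  simpa [inner_add_right, Finset.sum_add_distrib] using add_nonneg (hA v) (hB v)

omit [CompleteSpace H] in
theorem IsPositiveBlock.sum {n : ℕ} {ι : Type*} (s : Finset ι)
    {A : ι → Fin n → Fin n → traceClass H} (hA : ∀ k ∈ s, IsPositiveBlock (A k)) :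
    IsPositiveBlock fun i j => ∑ k ∈ s, A k i j := by
  classical
  induction s using Finset.induction_on with
  | empty => intro v; simp
  | insert k s hk ih =>
    simp only [Finset.sum_insert hk]
    exact (hA k (by simp)).add (ih fun l hl => hA l (by simp [hl]))

theorem IsPositiveBlock.conjLM {n : ℕ} {A : Fin n → Fin n → traceClass H}
    (hA : IsPositiveBlock A) (T : H →L[ℂ] K) :
    IsPositiveBlock fun i j => conjLM T (A i j) := by
  intro v
  simpa [coe_conjLM_apply, ContinuousLinearMap.adjoint_inner_left] using
    hA fun i => ContinuousLinearMap.adjoint T (v i)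

/-- Test positivity on the vectors `c i • b l` for each basis vector `b l`, then sum over `l`. -/
theorem IsPositiveBlock.trace_nonneg {n : ℕ} {A : Fin n → Fin n → traceClass H}
    (hA : IsPositiveBlock A) (c : Fin n → ℂ) :
    0 ≤ ∑ i, ∑ j, star (c i) * c j * trace (A i j : H →L[ℂ] H) := by
  refine (hasSum_sum fun i _ => hasSum_sum fun j _ =>
    (hasSum_trace (A i j)).mul_left (star (c i) * c j)).nonneg fun l => ?_
  have := hA fun i => c i • (exists_hilbertBasis ℂ H).choose_spec.choose l
  convert this using 4 with i _ j _
  simp only [map_smul, inner_smul_left, inner_smul_right, Complex.star_def]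
  ring

omit [CompleteSpace K] in
theorem IsPositiveBlock.trace_smul_ketBra {n : ℕ} {A : Fin n → Fin n → traceClass H}
    (hA : IsPositiveBlock A) (f : K) :
    IsPositiveBlock fun i j => trace (A i j : H →L[ℂ] H) • ketBra f f := by
  intro v
  have := hA.trace_nonneg fun i => ⟪f, v i⟫_ℂ
  convert this using 4 with i _ j _
  simp
  ring

end Channel

/-! ### The covariant channel attached to a character -/

section Conversion

variable {G H K : Type*} [Group G] [TopologicalSpace G] [IsTopologicalGroup G] [CompactSpace G]
  [NormedAddCommGroup H] [InnerProductSpace ℂ H] [CompleteSpace H]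
  [NormedAddCommGroup K] [InnerProductSpace ℂ K] [CompleteSpace K]

theorem covariantlyConvertible_of_character (U : UnitaryRep G H) (V : UnitaryRep G K) (ψ : H)
    {φ : K} (hφ : φ ≠ 0) (η : G →* Circle)
    (h : ∀ g, charFunction U ψ g = charFunction V φ g * (η g : ℂ)) :
    CovariantlyConvertible U V (pureState ψ) (pureState φ) := by
  obtain ⟨M, _, W, hψM, hWψ, hinv, hWU, hW⟩ := exists_intertwiner U V ψ φ η h
  have : Nontrivial K := ⟨φ, 0, hφ⟩
  obtain ⟨τ, hτ1, hτV, m, f, hτ⟩ := V.exists_invariant_state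
  let Q : H →L[ℂ] H := Mᗮ.starProjection
  have hQ : ∀ v, Q v = v - M.starProjection v := fun v => Submodule.starProjection_orthogonal_val v
  have hQψ : Q ψ = 0 := by
    rw [hQ, Submodule.starProjection_eq_self_iff.2 hψM, sub_self]
  have hQU : ∀ g, Q ∘L U.op g = U.op g ∘L Q := fun g => by
    ext v
    simp only [ContinuousLinearMap.comp_apply, hQ, map_sub, U.starProjection_op_apply M hinv]
  have hWQ : ∀ x y, ⟪W x, W y⟫_ℂ + ⟪Q x, Q y⟫_ℂ = ⟪x, y⟫_ℂ := fun x y => by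
    have h1 : ⟪M.starProjection x, Q y⟫_ℂ = 0 := Submodule.inner_right_of_mem_orthogonal
      (M.starProjection_apply_mem x) (Mᗮ.starProjection_apply_mem y)
    have h2 : ⟪Q x, M.starProjection y⟫_ℂ = 0 := Submodule.inner_left_of_mem_orthogonal
      (M.starProjection_apply_mem y) (Mᗮ.starProjection_apply_mem x)
    have hx : x = M.starProjection x + Q x := by rw [hQ]; abel
    have hy : y = M.starProjection y + Q y := by rw [hQ]; abel
    conv_rhs => rw [hx, hy]
    rw [hW, inner_add_left, inner_add_right, inner_add_right, h1, h2]
    ring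
  -- The part of the input outside `M` is discarded and replaced by `τ`, which restores the trace;
  -- `ψ ∈ M` loses nothing.
  let Φ : traceClass H →ₗ[ℂ] traceClass K :=
    conjLM W + (traceLM H ∘ₗ conjLM Q).smulRight τ
  have hΦ : ∀ A, Φ A = conjLM W A + trace (conjLM Q A : H →L[ℂ] H) • τ := fun A => rfl
  refine ⟨Φ, ⟨fun n A hA => ?_, fun A => ?_⟩, fun g A => ?_, ?_⟩
  · simp only [hΦ, hτ, Finset.smul_sum]
    exact (hA.conjLM W).add
      (IsPositiveBlock.sum _ fun k _ => (hA.conjLM Q).trace_smul_ketBra (f k))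
  · rw [hΦ, trace_add, trace_smul, hτ1, mul_one]
    exact trace_conjLM_add W Q hWQ A
  · have h1 : conjLM W (conjBy (U.op g) A) = conjBy (V.op g) (conjLM W A) := by
      simp only [conjBy_eq_conjLM, conjLM_conjLM, hWU, conjLM_circle_smul]
    have h2 : trace (conjLM Q (conjBy (U.op g) A) : H →L[ℂ] H)
        = trace (conjLM Q A : H →L[ℂ] H) := by
      rw [conjBy_eq_conjLM, conjLM_conjLM, hQU, ← conjLM_conjLM]
      refine trace_conjLM_of_inner _ (fun x y => ?_) _
      rw [U.inner_op_op, inv_mul_cancel, U.op_one_apply]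
    rw [hΦ, hΦ, h1, h2]
    simp only [conjBy_eq_conjLM, map_add, map_smul]
    rw [← conjBy_eq_conjLM _ τ, hτV]
  · have h1 : Φ (ketBra ψ ψ) = ketBra φ φ := by
      rw [hΦ, conjLM_ketBra, conjLM_ketBra, hWψ, hQψ, trace_ketBra, inner_zero_left, zero_smul,
        add_zero]
    exact h1

theorem gEquivalent_of_character (U : UnitaryRep G H) (V : UnitaryRep G K) {ψ : H} {φ : K}
    (hψ : ψ ≠ 0) (hφ : φ ≠ 0) (η : G →* Circle)
    (h : ∀ g, charFunction U ψ g = charFunction V φ g * (η g : ℂ)) :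
    GEquivalent U V (pureState ψ) (pureState φ) := by
  refine ⟨covariantlyConvertible_of_character U V ψ hφ η h,
    covariantlyConvertible_of_character V U φ hψ η⁻¹ fun g => ?_⟩
  rw [h g, mul_assoc, ← Circle.coe_mul, MonoidHom.inv_apply, mul_inv_cancel, Circle.coe_one,
    mul_one]

end Conversion

end Asymmetry

theorem theorem3
    {E G H K : Type*}
    [NormedAddCommGroup E] [NormedSpace ℝ E] [FiniteDimensional ℝ E]
    [Group G] [TopologicalSpace G] [T2Space G] [ChartedSpace E G] [LieGroup 𝓘(ℝ, E) ∞ G]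
    [CompactSpace G]
    [NormedAddCommGroup H] [InnerProductSpace ℂ H] [CompleteSpace H]
    [NormedAddCommGroup K] [InnerProductSpace ℂ K] [CompleteSpace K]
    (U : UnitaryRep G H) (V : UnitaryRep G K)
    (ψ : H) (φ : K) (hψ : ‖ψ‖ = 1) (hφ : ‖φ‖ = 1) :
    ((∃ η : G →ₜ* Circle, ∀ g, charFunction U ψ g = charFunction V φ g * (η g : ℂ)) →
      GEquivalent U V (pureState ψ) (pureState φ)) ∧
    ((ConnectedSpace G ∨ ∀ g, charFunction U ψ g ≠ 0 ∧ charFunction V φ g ≠ 0) →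
      (GEquivalent U V (pureState ψ) (pureState φ) ↔
        ∃ η : G →ₜ* Circle, ∀ g, charFunction U ψ g = charFunction V φ g * (η g : ℂ))) := by
  have : IsTopologicalGroup G := topologicalGroup_of_lieGroup 𝓘(ℝ, E) ∞
  have hψ0 : ψ ≠ 0 := norm_ne_zero_iff.1 (by simp [hψ])
  have hφ0 : φ ≠ 0 := norm_ne_zero_iff.1 (by simp [hφ])
  have hfwd : (∃ η : G →ₜ* Circle, ∀ g, charFunction U ψ g = charFunction V φ g * (η g : ℂ)) →
      GEquivalent U V (pureState ψ) (pureState φ) := fun ⟨η, hη⟩ =>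
    gEquivalent_of_character U V hψ0 hφ0 η.toMonoidHom hη
  exact ⟨hfwd, fun hG => ⟨fun h => h.exists_character hψ hφ (hG.imp_right fun h g => (h g).1),
    hfwd⟩⟩
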